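/- All Banach spaces are real. A subset $A$ of a topological space $T$ is called $\mathcal{K}_{\sigma\delta}$ if there is a family $(K_{n,m})_{n,m\in\mathbb{N}}$ of compact subsets of $T$ with $A=\bigcap_{n}\bigcup_{m}K_{n,m}$; it is called strongly $\mathcal{K}_{\sigma\delta}$ if this family can be chosen so that, moreover, for every compact $L\subseteq A$ and every $n$ there is an $m$ with $L\subseteq K_{n,m}$. A Banach space $E$ is called $\mathcal{K}_{\sigma\delta}$ (respectively strongly $\mathcal{K}_{\sigma\delta}$) if its canonical image in its second dual $E^{**}$, endowed with the weak$^*$ topology $\sigma(E^{**},E^*)$, is a $\mathcal{K}_{\sigma\delta}$ (respectively strongly $\mathcal{K}_{\sigma\delta}$) subset of $E^{**}$. Let $(X_n)_{n\in\mathbb{N}}$ be a sequence of Banach spaces and let $1\le p<\infty$. Let $X=\left(\sum_{n}\oplus X_n\right)_p$ be the Banach space of all sequences $(x_n)$ with $x_n\in X_n$ and $\|(x_n)\|=\left(\sum_n\|x_n\|^p\right)^{1/p}<\infty$. (a) If every $X_n$ is $\mathcal{K}_{\sigma\delta}$, then $X$ is $\mathcal{K}_{\sigma\delta}$. (b) If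 every $X_n$ is strongly $\mathcal{K}_{\sigma\delta}$, then $X$ is strongly $\mathcal{K}_{\sigma\delta}$. -/

import Mathlib

open scoped ENNReal

/-- A subset `A` of a topological space is `K_{σδ}` if it is of the form `⋂ n, ⋃ m, K n m` for a
countable family of compact sets `K n m`. -/
def IsKSigmaDelta {T : Type*} [TopologicalSpace T] (A : Set T) : Prop :=
  ∃ K : ℕ → ℕ → Set T, (∀ n m, IsCompact (K n m)) ∧ A = ⋂ n, ⋃ m, K n m

/-- A subset `A` of a topological space is strongly `K_{σδ}` if `A = ⋂ n, ⋃ m, K n m` for a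
countable family of compact sets `K n m` such that for every compact `L ⊆ A` and every `n`
there is an `m` with `L ⊆ K n m`. -/
def IsStronglyKSigmaDelta {T : Type*} [TopologicalSpace T] (A : Set T) : Prop :=
  ∃ K : ℕ → ℕ → Set T, (∀ n m, IsCompact (K n m)) ∧ A = (⋂ n, ⋃ m, K n m) ∧
    ∀ L : Set T, IsCompact L → L ⊆ A → ∀ n, ∃ m, L ⊆ K n m

/-- The canonical image of a real normed space `E` in its second dual `E**`, as a subset of
`E**` with the weak* topology `σ(E**, E*)`. -/
def canonicalImage (E : Type*) [NormedAddCommGroup E] [NormedSpace ℝ E] :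
    Set (WeakDual ℝ (StrongDual ℝ E)) :=
  Set.range fun x : E => StrongDual.toWeakDual (NormedSpace.inclusionInDoubleDual ℝ E x)

/-- A real Banach space `E` is `K_{σδ}` if it is a `K_{σδ}` subset of `(E**, w*)`. -/
def IsKSigmaDeltaBanach (E : Type*) [NormedAddCommGroup E] [NormedSpace ℝ E]
    [CompleteSpace E] : Prop :=
  IsKSigmaDelta (canonicalImage E)

/-- A real Banach space `E` is strongly `K_{σδ}` if it is a strongly `K_{σδ}` subset of
`(E**, w*)`. -/
def IsStronglyKSigmaDeltaBanach (E : Type*) [NormedAddCommGroup E] [NormedSpace ℝ E]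
    [CompleteSpace E] : Prop :=
  IsStronglyKSigmaDelta (canonicalImage E)

open Filter Topology Set

/-! An element `z` of the second dual of the sum `X` has a coordinate in each `X_i**`, its image
under the weak*-continuous second adjoint of the `i`-th projection. For `1 < p < ∞` every functional
on `X` has tails tending to `0` in norm (`tendsto_norm_comp_lpTail`), so `z` lies in `X` as soon as
each coordinate lies in `X_i`; thus `X` is a countable intersection of continuous preimages of the
given sets. For `p = 1` this fails, since `z` may live at infinity, and one adds the condition that
`z` has small tails, a countable intersection of countable unions of closed sets
(`canonicalImage_lp_eq`). Cutting with balls of integer radius turns closed sets into compact ones.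
For the strong version, a compact `L` is absorbed coordinatewise through its images. When `p = 1`
the tail condition must absorb `L` as well: weakly compact subsets of an `ℓ^1`-sum have uniformly
small tails, a Schur-type fact proved by a Baire category argument
(`exists_forall_norm_lpTail_le_of_isCompact`). -/

/-- The common form of the two notions: `A = ⋂ n, ⋃ m, K n m` with `K n m` compact, where the
absorption of compact subsets of `A` is required only if `s` holds. -/
def IsKSigmaDeltaIf {T : Type*} [TopologicalSpace T] (s : Prop) (A : Set T) : Prop :=
  ∃ K : ℕ → ℕ → Set T, (∀ n m, IsCompact (K n m)) ∧ A = (⋂ n, ⋃ m, K n m) ∧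
    (s → ∀ L : Set T, IsCompact L → L ⊆ A → ∀ n, ∃ m, L ⊆ K n m)

/-! ### Stability of the two set classes -/

theorem isKSigmaDeltaIf_true {T : Type*} [TopologicalSpace T] {A : Set T} :
    IsKSigmaDeltaIf True A ↔ IsStronglyKSigmaDelta A := by
  simp [IsKSigmaDeltaIf, IsStronglyKSigmaDelta]

theorem isKSigmaDeltaIf_false {T : Type*} [TopologicalSpace T] {A : Set T} :
    IsKSigmaDeltaIf False A ↔ IsKSigmaDelta A := by
  simp [IsKSigmaDeltaIf, IsKSigmaDelta]

theorem IsKSigmaDeltaIf.of_countable {T : Type*} [TopologicalSpace T] {s : Prop} {A : Set T}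
    {ι κ : Type*} [Countable ι] [Nonempty ι] [Countable κ] [Nonempty κ] (K : ι → κ → Set T)
    (hK : ∀ i j, IsCompact (K i j)) (hA : A = ⋂ i, ⋃ j, K i j)
    (hs : s → ∀ L : Set T, IsCompact L → L ⊆ A → ∀ i, ∃ j, L ⊆ K i j) :
    IsKSigmaDeltaIf s A := by
  obtain ⟨a, ha⟩ := exists_surjective_nat ι
  obtain ⟨b, hb⟩ := exists_surjective_nat κ
  refine ⟨fun n m => K (a n) (b m), fun n m => hK _ _, ?_, fun h L hL hLA n => ?_⟩
  · rw [hA, ← ha.iInter_comp]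
    exact iInter_congr fun n => (hb.iUnion_comp _).symm
  · obtain ⟨j, hj⟩ := hs h L hL hLA (a n)
    obtain ⟨m, rfl⟩ := hb j
    exact ⟨m, hj⟩

/-- Preimages of compact sets are only closed, so each is cut by some `B r`; since a compact `L`
lies in a single `B r`, the cut does not spoil absorption. -/
theorem IsKSigmaDeltaIf.iInter_preimage_inter {Z : Type*} [TopologicalSpace Z] [T2Space Z]
    {Y : ℕ → Type*} [∀ n, TopologicalSpace (Y n)] [∀ n, T2Space (Y n)] {s : Prop}
    {B : ℕ → Set Z} (hB : ∀ r, IsCompact (B r)) (hB' : ∀ L : Set Z, IsCompact L → ∃ r, L ⊆ B r)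
    {f : ∀ n, Z → Y n} (hf : ∀ n, Continuous (f n)) {A : ∀ n, Set (Y n)}
    (hA : ∀ n, IsKSigmaDeltaIf s (A n)) {D : ℕ → ℕ → Set Z} (hD : ∀ k n, IsClosed (D k n))
    (hs : s → ∀ L : Set Z, IsCompact L → L ⊆ (⋂ n, f n ⁻¹' A n) ∩ ⋂ k, ⋃ n, D k n →
      ∀ k, ∃ n, L ⊆ D k n) :
    IsKSigmaDeltaIf s ((⋂ n, f n ⁻¹' A n) ∩ ⋂ k, ⋃ n, D k n) := by
  choose K hK hAK hKs using hA
  let C : (ℕ × ℕ) ⊕ ℕ → ℕ × ℕ → Set Z :=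
    Sum.elim (fun q t => f q.1 ⁻¹' K q.1 q.2 t.1 ∩ B t.2) (fun k t => D k t.1 ∩ B t.2)
  refine .of_countable C ?_ ?_ ?_
  · rintro (q | k) t
    · exact (hB _).inter_left ((hK _ _ _).isClosed.preimage (hf _))
    · exact (hB _).inter_left (hD _ _)
  · ext z
    obtain ⟨r, hr⟩ := hB' {z} isCompact_singleton
    have hzr : z ∈ B r := hr rfl
    simp only [mem_inter_iff, mem_iInter, mem_preimage, mem_iUnion]
    constructor
    · rintro ⟨h1, h2⟩ (q | k)
      · have := h1 q.1
        rw [hAK q.1] at this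
        obtain ⟨m, hm⟩ := mem_iUnion.1 (mem_iInter.1 this q.2)
        exact ⟨(m, r), hm, hzr⟩
      · obtain ⟨n, hn⟩ := h2 k
        exact ⟨(n, r), hn, hzr⟩
    · intro h
      refine ⟨fun n => ?_, fun k => ?_⟩
      · rw [hAK n]
        refine mem_iInter.2 fun j => ?_
        obtain ⟨t, ht⟩ := h (.inl (n, j))
        exact mem_iUnion.2 ⟨t.1, ht.1⟩
      · obtain ⟨t, ht⟩ := h (.inr k)
        exact ⟨t.1, ht.1⟩
  · intro h L hL hLA
    obtain ⟨r, hr⟩ := hB' L hL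
    rintro (q | k)
    · obtain ⟨m, hm⟩ := hKs q.1 h (f q.1 '' L) (hL.image (hf _))
        (image_subset_iff.2 fun z hz => mem_iInter.1 (hLA hz).1 q.1) q.2
      exact ⟨(m, r), subset_inter (image_subset_iff.1 hm) hr⟩
    · obtain ⟨n, hn⟩ := hs h L hL hLA k
      exact ⟨(n, r), subset_inter hn hr⟩

/-! ### Second duals and second adjoints -/

/-- This is the uniform boundedness principle. -/
theorem WeakDual.exists_nat_subset_closedBall {E : Type*} [NormedAddCommGroup E] [NormedSpace ℝ E]
    [CompleteSpace E] {L : Set (WeakDual ℝ E)} (hL : IsCompact L) :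
    ∃ r : ℕ, L ⊆ WeakDual.toStrongDual ⁻¹' Metric.closedBall (0 : StrongDual ℝ E) r := by
  have h1 : Bornology.IsBounded L := (WeakDual.isBounded_iff_isVonNBounded (𝕜 := ℝ)).2
    (hL.isVonNBounded ℝ)
  have h2 : Bornology.IsBounded (StrongDual.toWeakDual ⁻¹' L : Set (StrongDual ℝ E)) :=
    (WeakDual.isBounded_toWeakDual_preimage_iff_isBounded (𝕜 := ℝ)).2 h1
  obtain ⟨R, hR⟩ := h2.subset_closedBall (0 : StrongDual ℝ E)
  obtain ⟨r, hr⟩ := exists_nat_ge R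
  exact ⟨r, fun z hz => Metric.closedBall_subset_closedBall (α := StrongDual ℝ E) hr
    (hR (a := WeakDual.toStrongDual z) hz)⟩

/-- The second adjoint of `T`, as a map between the second duals with their weak* topologies. -/
noncomputable def biadjoint {E F : Type*} [NormedAddCommGroup E] [NormedSpace ℝ E]
    [NormedAddCommGroup F] [NormedSpace ℝ F] (T : E →L[ℝ] F)
    (z : WeakDual ℝ (StrongDual ℝ E)) : WeakDual ℝ (StrongDual ℝ F) :=
  StrongDual.toWeakDual ((WeakDual.toStrongDual z).comp (ContinuousLinearMap.precomp ℝ T))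

theorem continuous_biadjoint {E F : Type*} [NormedAddCommGroup E] [NormedSpace ℝ E]
    [NormedAddCommGroup F] [NormedSpace ℝ F] (T : E →L[ℝ] F) : Continuous (biadjoint T) :=
  WeakDual.continuous_of_continuous_eval fun g => WeakDual.eval_continuous (g.comp T)

theorem mem_canonicalImage_iff {E : Type*} [NormedAddCommGroup E] [NormedSpace ℝ E]
    {z : WeakDual ℝ (StrongDual ℝ E)} :
    z ∈ canonicalImage E ↔ ∃ x : E, ∀ f : StrongDual ℝ E, z f = f x := by
  constructor
  · rintro ⟨x, rfl⟩
    exact ⟨x, fun f => rfl⟩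
  · rintro ⟨x, hx⟩
    exact ⟨x, DFunLike.ext _ _ fun f => (hx f).symm⟩

theorem LinearIsometry.mem_range_of_forall_exists_norm_sub_le {E F : Type*} [NormedAddCommGroup E]
    [NormedSpace ℝ E] [CompleteSpace E] [NormedAddCommGroup F] [NormedSpace ℝ F] (J : E →ₗᵢ[ℝ] F)
    {y : F} (h : ∀ ε > 0, ∃ x, ‖y - J x‖ ≤ ε) : ∃ x, J x = y := by
  have hcl : IsClosed (range J) := J.isometry.isUniformInducing.isComplete_range.isClosed
  have hy : y ∈ closure (range J) := Metric.mem_closure_range_iff.2 fun ε hε => by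
    obtain ⟨x, hx⟩ := h (ε / 2) (half_pos hε)
    exact ⟨x, by rw [dist_eq_norm]; linarith⟩
  rwa [hcl.closure_eq] at hy

theorem mem_canonicalImage_of_forall_exists_abs_sub_le {E : Type*} [NormedAddCommGroup E]
    [NormedSpace ℝ E] [CompleteSpace E] {z : WeakDual ℝ (StrongDual ℝ E)}
    (h : ∀ ε > 0, ∃ x : E, ∀ f : StrongDual ℝ E, |z f - f x| ≤ ε * ‖f‖) :
    z ∈ canonicalImage E := by
  refine (NormedSpace.inclusionInDoubleDualLi ℝ (E := E)).mem_range_of_forall_exists_norm_sub_le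
    (y := WeakDual.toStrongDual z) fun ε hε => ?_
  obtain ⟨x, hx⟩ := h ε hε
  exact ⟨x, ContinuousLinearMap.opNorm_le_bound _ hε.le hx⟩

/-! ### Truncations and tails in `ℓ^p`-sums -/

theorem toReal_pos_of_one_le (p : ℝ≥0∞) [Fact (1 ≤ p)] (hp : p ≠ ∞) : 0 < p.toReal :=
  ENNReal.toReal_pos (zero_lt_one.trans_le Fact.out).ne' hp

theorem sum_single_apply {X : ℕ → Type*} [∀ n, NormedAddCommGroup (X n)] {p : ℝ≥0∞}
    (n : ℕ) (x : ∀ i, X i) (j : ℕ) :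
    (∑ i ∈ Finset.range n, lp.single p i (x i) : lp X p) j = if j < n then x j else 0 := by
  simp only [lp.coeFn_sum, lp.coeFn_single, Finset.sum_apply, Finset.sum_pi_single,
    Finset.mem_range]

theorem norm_sum_single_le {X : ℕ → Type*} [∀ n, NormedAddCommGroup (X n)] {p : ℝ≥0∞}
    [Fact (1 ≤ p)] (hp : p ≠ ∞) (n : ℕ) (x : lp X p) :
    ‖(∑ i ∈ Finset.range n, lp.single p i (x i) : lp X p)‖ ≤ ‖x‖ := by
  have h0 := toReal_pos_of_one_le p hp
  rw [← Real.rpow_le_rpow_iff (norm_nonneg _) (norm_nonneg _) h0, lp.norm_sum_single h0]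
  exact lp.sum_rpow_le_norm_rpow h0 _ _

section LpTail

variable {X : ℕ → Type*} [∀ n, NormedAddCommGroup (X n)] [∀ n, NormedSpace ℝ (X n)]
  {p : ℝ≥0∞} [Fact (1 ≤ p)]

/-- The projection of the `ℓ^p`-sum that sets the first `n` coordinates to zero. -/
noncomputable def lpTail (X : ℕ → Type*) [∀ n, NormedAddCommGroup (X n)]
    [∀ n, NormedSpace ℝ (X n)] (p : ℝ≥0∞) [Fact (1 ≤ p)] (n : ℕ) : lp X p →L[ℝ] lp X p :=
  ContinuousLinearMap.id ℝ _ - ∑ i ∈ Finset.range n,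
    (lp.singleContinuousLinearMap ℝ X p i).comp (lp.evalCLM ℝ X p i)

theorem lpTail_eq (n : ℕ) (x : lp X p) :
    lpTail X p n x = x - ∑ i ∈ Finset.range n, lp.single p i (x i) := by
  simp only [lpTail, sub_apply, sum_apply,
    ContinuousLinearMap.id_apply, ContinuousLinearMap.comp_apply]
  rfl

theorem lpTail_apply (n : ℕ) (x : lp X p) (j : ℕ) :
    lpTail X p n x j = if j < n then 0 else x j := by
  rw [lpTail_eq, lp.coeFn_sub, Pi.sub_apply, sum_single_apply]
  split_ifs <;> simp

theorem norm_lpTail_apply_le (hp : p ≠ ∞) (n : ℕ) (x : lp X p) : ‖lpTail X p n x‖ ≤ ‖x‖ := by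
  have h0 := toReal_pos_of_one_le p hp
  rw [lpTail_eq, ← Real.rpow_le_rpow_iff (norm_nonneg _) (norm_nonneg _) h0,
    lp.norm_compl_sum_single h0]
  exact sub_le_self _ (Finset.sum_nonneg fun i _ => by positivity)

theorem tendsto_lpTail (hp : p ≠ ∞) (x : lp X p) :
    Tendsto (fun n => lpTail X p n x) atTop (𝓝 0) := by
  have h := (lp.hasSum_single hp x).tendsto_sum_nat
  simpa only [lpTail_eq, sub_self] using (tendsto_const_nhds (x := x)).sub h

/-- An element of the second dual of the sum whose coordinates lie in the summands is determined by
these up to its values on functionals that vanish on the first `n` summands. -/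
theorem eq_comp_lpTail_add_sum {z : WeakDual ℝ (StrongDual ℝ (lp X p))} {x : ∀ i, X i}
    (hx : ∀ i g, biadjoint (lp.evalCLM ℝ X p i) z g = g (x i)) (n : ℕ)
    (f : StrongDual ℝ (lp X p)) :
    z f = z (f.comp (lpTail X p n)) + f (∑ i ∈ Finset.range n, lp.single p i (x i)) := by
  have h : f = f.comp (lpTail X p n) + ∑ i ∈ Finset.range n,
      (f.comp (lp.singleContinuousLinearMap ℝ X p i)).comp (lp.evalCLM ℝ X p i) := by
    ext y
    simp only [add_apply, ContinuousLinearMap.comp_apply, lpTail_eq, map_sub,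
      sum_apply, map_sum]
    exact (sub_add_cancel _ _).symm
  conv_lhs => rw [h]
  rw [map_add, map_sum, map_sum]
  congr 1
  exact Finset.sum_congr rfl fun i _ => hx i (f.comp (lp.singleContinuousLinearMap ℝ X p i))

theorem biadjoint_evalCLM_mem {z : WeakDual ℝ (StrongDual ℝ (lp X p))}
    (hz : z ∈ canonicalImage (lp X p)) (i : ℕ) :
    biadjoint (lp.evalCLM ℝ X p i) z ∈ canonicalImage (X i) := by
  obtain ⟨x, hx⟩ := mem_canonicalImage_iff.1 hz
  exact mem_canonicalImage_iff.2 ⟨x i, fun g => hx _⟩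

end LpTail

/-! ### Weakly compact sets in `ℓ^1`-sums -/

section ExponentOne

theorem hasSum_norm_lp_one {X : ℕ → Type*} [∀ n, NormedAddCommGroup (X n)] (x : lp X 1) :
    HasSum (fun i => ‖x i‖) ‖x‖ := by
  simpa using lp.hasSum_norm (p := 1) (by simp) x

variable {X : ℕ → Type*} [∀ n, NormedAddCommGroup (X n)] [∀ n, NormedSpace ℝ (X n)]

theorem exists_strongDual_lp_one (g : ∀ i, StrongDual ℝ (X i)) (hg : ∀ i, ‖g i‖ ≤ 1) :
    ∃ h : StrongDual ℝ (lp X 1), ∀ x : lp X 1, HasSum (fun i => g i (x i)) (h x) := by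
  have hle : ∀ (x : lp X 1) i, ‖g i (x i)‖ ≤ ‖x i‖ := fun x i =>
    ((g i).le_opNorm _).trans (mul_le_of_le_one_left (norm_nonneg _) (hg i))
  have hs : ∀ x : lp X 1, HasSum (fun i => g i (x i)) (∑' i, g i (x i)) := fun x =>
    (Summable.of_norm_bounded (hasSum_norm_lp_one x).summable (hle x)).hasSum
  let h : lp X 1 →ₗ[ℝ] ℝ :=
    { toFun := fun x => ∑' i, g i (x i)
      map_add' := fun x y => (hs (x + y)).unique <| by
        simpa using (hs x).add (hs y)
      map_smul' := fun a x => (hs (a • x)).unique <| by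
        simpa using (hs x).mul_left a }
  refine ⟨h.mkContinuous 1 fun x => ?_, hs⟩
  rw [one_mul]
  exact tsum_of_norm_bounded (hasSum_norm_lp_one x) (hle x)

/-- There are uncountably many `h c`, but on `L` each is determined by the countably many
functionals `g q i` of the coordinates. These map `L` onto a compact metrizable set, so one
subsequence serves all `c` at once. -/
theorem exists_subseq_tendsto_of_coordinates {κ : Type*} [Countable κ]
    {L : Set (WeakDual ℝ (StrongDual ℝ (lp X 1)))} (hL : IsCompact L)
    (hLA : L ⊆ canonicalImage (lp X 1)) {u : ℕ → lp X 1}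
    (hu : ∀ k, StrongDual.toWeakDual (NormedSpace.inclusionInDoubleDual ℝ (lp X 1) (u k)) ∈ L)
    (g : κ → ∀ i, StrongDual ℝ (X i)) {h : (ℕ → κ) → StrongDual ℝ (lp X 1)}
    (hh : ∀ c x, HasSum (fun i => g (c i) i (x i)) (h c x)) :
    ∃ φ : ℕ → ℕ, StrictMono φ ∧ ∀ c, ∃ a, Tendsto (fun k => h c (u (φ k))) atTop (𝓝 a) := by
  let Ψ : WeakDual ℝ (StrongDual ℝ (lp X 1)) → κ × ℕ → ℝ := fun z q =>
    z ((g q.1 q.2).comp (lp.evalCLM ℝ X 1 q.2))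
  have hΨ : Continuous Ψ := continuous_pi fun q => WeakDual.eval_continuous _
  obtain ⟨_, ⟨z₀, hz₀, rfl⟩, φ, hφ, hlim⟩ := (hL.image hΨ).tendsto_subseq
    fun k => mem_image_of_mem Ψ (hu k)
  refine ⟨φ, hφ, fun c => ⟨z₀ (h c), ?_⟩⟩
  have hdet : ∀ z ∈ L, Ψ z = Ψ z₀ → z (h c) = z₀ (h c) := by
    intro z hz hzz
    obtain ⟨x, hx⟩ := mem_canonicalImage_iff.1 (hLA hz)
    obtain ⟨x₀, hx₀⟩ := mem_canonicalImage_iff.1 (hLA hz₀)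
    rw [hx, hx₀]
    refine (hh c x).unique ?_
    convert! hh c x₀ using 2 with i
    have := congrFun hzz (c i, i)
    simp only [Ψ, hx, hx₀] at this
    exact this
  -- Along any ultrafilter the sequence has a weak* limit `z` in `L`; it has the same coordinate
  -- data as `z₀`, so `h c` takes the same value at both.
  rw [tendsto_iff_ultrafilter]
  intro U hU
  let w : ℕ → WeakDual ℝ (StrongDual ℝ (lp X 1)) := fun k =>
    StrongDual.toWeakDual (NormedSpace.inclusionInDoubleDual ℝ (lp X 1) (u (φ k)))
  obtain ⟨z, hz, hUz⟩ := hL.ultrafilter_le_nhds (U.map w)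
    (le_principal_iff.2 (mem_map.2 (univ_mem' fun k => hu (φ k))))
  have hUz' : Tendsto w U (𝓝 z) := hUz
  have hzz : Ψ z = Ψ z₀ :=
    tendsto_nhds_unique ((hΨ.tendsto z).comp hUz') (hlim.mono_left hU)
  rw [← hdet z hz hzz]
  exact ((WeakDual.eval_continuous (h c)).tendsto z).comp hUz'

theorem exists_cylinder_subset_of_isOpen {κ : Type*} [TopologicalSpace κ] {U : Set (ℕ → κ)}
    (hU : IsOpen U) {c₀ : ℕ → κ} (hc₀ : c₀ ∈ U) :
    ∃ M, ∀ c : ℕ → κ, (∀ i < M, c i = c₀ i) → c ∈ U := by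
  obtain ⟨I, v, hv, hsub⟩ := isOpen_pi_iff.1 hU c₀ hc₀
  obtain ⟨M, hM⟩ := I.exists_nat_subset_range
  refine ⟨M, fun c hc => hsub fun i hi => ?_⟩
  rw [hc i (Finset.mem_range.1 (hM hi))]
  exact (hv i hi).2

/-- Weakly compact subsets of an `ℓ^1`-sum have uniformly small tails. -/
theorem exists_forall_norm_lpTail_le_of_isCompact
    {L : Set (WeakDual ℝ (StrongDual ℝ (lp X 1)))} (hL : IsCompact L)
    (hLA : L ⊆ canonicalImage (lp X 1)) {ε : ℝ} (hε : 0 < ε) :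
    ∃ n, ∀ x : lp X 1, StrongDual.toWeakDual (NormedSpace.inclusionInDoubleDual ℝ (lp X 1) x) ∈ L →
      ‖lpTail X 1 n x‖ ≤ ε := by
  by_contra! hcon
  choose u huL hu using hcon
  -- `g (k, l) i` norms the `i`-th coordinate of `u k - u l`; a sequence `c` selects one such
  -- functional in each coordinate.
  choose g hg1 hg using fun (q : ℕ × ℕ) (i : ℕ) => exists_dual_vector'' ℝ ((u q.1 - u q.2) i)
  choose h hh using fun c : ℕ → ℕ × ℕ =>
    exists_strongDual_lp_one (fun i => g (c i) i) fun i => hg1 (c i) i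
  obtain ⟨φ, hφ, hlim⟩ := exists_subseq_tendsto_of_coordinates hL hLA huL g hh
  -- Baire category in the space of selections `c`: the pointwise Cauchy property becomes uniform on
  -- a cylinder, where only the first `M` choices are prescribed.
  let F : ℕ → Set (ℕ → ℕ × ℕ) := fun N =>
    {c | ∀ k ≥ N, ∀ l ≥ N, |h c (u (φ k) - u (φ l))| ≤ ε / 4}
  have hcont : ∀ x : lp X 1, Continuous fun c => h c x := by
    intro x
    have : (fun c => h c x) = fun c => ∑' i, g (c i) i (x i) :=
      funext fun c => (hh c x).tsum_eq.symm
    rw [this]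
    refine continuous_tsum (fun i => ?_) (hasSum_norm_lp_one x).summable fun i c =>
      ((g (c i) i).le_opNorm _).trans (mul_le_of_le_one_left (norm_nonneg _) (hg1 (c i) i))
    exact (continuous_of_discreteTopology (f := fun q : ℕ × ℕ => g q i (x i))).comp
      (continuous_apply i)
  have hFclosed : ∀ N, IsClosed (F N) := by
    intro N
    simp only [F, ofPred_forall]
    exact isClosed_iInter fun k => isClosed_iInter fun _ => isClosed_iInter fun l =>
      isClosed_iInter fun _ => isClosed_le (hcont _).abs continuous_const
  have hFcover : ⋃ N, F N = univ := by
    refine eq_univ_of_forall fun c => mem_iUnion.2 ?_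
    obtain ⟨a, ha⟩ := hlim c
    obtain ⟨N, hN⟩ := Metric.cauchySeq_iff.1 ha.cauchySeq (ε / 4) (by positivity)
    refine ⟨N, fun k hk l hl => ?_⟩
    rw [map_sub, ← Real.dist_eq]
    exact (hN k hk l hl).le
  obtain ⟨N, c₀, hc₀⟩ := nonempty_interior_of_iUnion_of_closed hFclosed hFcover
  obtain ⟨M, hM⟩ := exists_cylinder_subset_of_isOpen isOpen_interior hc₀
  have htail : ∀ k ≥ N, ∀ l ≥ N, ‖lpTail X 1 M (u (φ k) - u (φ l))‖ ≤ ε / 4 := by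
    intro k hk l hl
    set y := u (φ k) - u (φ l) with hy
    let c (q : ℕ × ℕ) : ℕ → ℕ × ℕ := fun i => if i < M then c₀ i else q
    have hc : ∀ q, |h (c q) y| ≤ ε / 4 := fun q =>
      interior_subset (hM (c q) fun i hi => if_pos hi) k hk l hl
    -- The two selections agree below `M`, so the head cancels; beyond `M` they norm `y i` and `-y
    -- i`, and their difference contributes `2 * ‖y i‖`.
    have hsum : h (c (φ k, φ l)) y - h (c (φ l, φ k)) y = 2 * ‖lpTail X 1 M y‖ := by
      refine ((hh (c (φ k, φ l)) y).sub (hh (c (φ l, φ k)) y)).unique ?_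
      convert! (hasSum_norm_lp_one (lpTail X 1 M y)).mul_left 2 using 2 with i
      rw [lpTail_apply]
      by_cases hi : i < M
      · simp [c, hi]
      · have h1 : g (φ k, φ l) i (y i) = ‖y i‖ := hg (φ k, φ l) i
        have h2 : g (φ l, φ k) i ((-y) i) = ‖(-y) i‖ := by
          rw [hy, neg_sub]
          exact hg (φ l, φ k) i
        rw [lp.coeFn_neg, Pi.neg_apply, map_neg, norm_neg] at h2
        simp only [c, hi, if_false, h1]
        linarith
    have h1 := abs_le.1 (hc (φ k, φ l))
    have h2 := abs_le.1 (hc (φ l, φ k))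
    linarith [h1.2, h2.1]
  -- The tail of `u (φ k)` beyond `φ k` exceeds `ε`, yet it is within `ε / 4` of the tail of the
  -- fixed vector `u (φ N)`, which is eventually below `ε / 4`.
  have hfix : ∀ᶠ k in atTop, ‖lpTail X 1 (φ k) (u (φ N))‖ < ε / 4 := by
    have := ((tendsto_lpTail ENNReal.one_ne_top (u (φ N))).comp hφ.tendsto_atTop).norm
    rw [norm_zero] at this
    exact this.eventually (gt_mem_nhds (by positivity))
  obtain ⟨k, hk1, hk2, hk3⟩ := (hfix.and ((eventually_ge_atTop N).and
    (hφ.tendsto_atTop.eventually_ge_atTop M))).exists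
  have h1 : ‖lpTail X 1 (φ k) (u (φ k) - u (φ N))‖ ≤ ε / 4 := by
    have : lpTail X 1 (φ k) (u (φ k) - u (φ N)) =
        lpTail X 1 (φ k) (lpTail X 1 M (u (φ k) - u (φ N))) := by
      ext j
      simp only [lpTail_apply]
      split_ifs <;> first | rfl | omega
    rw [this]
    exact (norm_lpTail_apply_le ENNReal.one_ne_top _ _).trans (htail k hk2 N le_rfl)
  have h2 := norm_add_le (lpTail X 1 (φ k) (u (φ k) - u (φ N))) (lpTail X 1 (φ k) (u (φ N)))
  rw [← map_add, sub_add_cancel] at h2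
  linarith [hu (φ k)]

end ExponentOne

/-! ### Functionals and second duals for `1 < p < ∞` -/

section ExponentGreaterOne

variable {X : ℕ → Type*} [∀ n, NormedAddCommGroup (X n)] [∀ n, NormedSpace ℝ (X n)]
  {p : ℝ≥0∞} [Fact (1 ≤ p)]

theorem norm_comp_lpTail_antitone (hp : p ≠ ∞) (f : StrongDual ℝ (lp X p)) :
    Antitone fun n => ‖f.comp (lpTail X p n)‖ := by
  intro n m hnm
  refine ContinuousLinearMap.opNorm_le_bound _ (norm_nonneg _) fun x => ?_
  have h : lpTail X p m x = lpTail X p n (lpTail X p m x) := by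
    ext j
    simp only [lpTail_apply]
    split_ifs <;> first | rfl | omega
  calc ‖f (lpTail X p m x)‖ = ‖(f.comp (lpTail X p n)) (lpTail X p m x)‖ := by
        rw [ContinuousLinearMap.comp_apply, ← h]
    _ ≤ ‖f.comp (lpTail X p n)‖ * ‖lpTail X p m x‖ := ContinuousLinearMap.le_opNorm _ _
    _ ≤ ‖f.comp (lpTail X p n)‖ * ‖x‖ := by gcongr; exact norm_lpTail_apply_le hp m x

theorem exists_block_of_lt_norm_comp_lpTail (hp : p ≠ ∞) {f : StrongDual ℝ (lp X p)} {n : ℕ} {ε : ℝ}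
    (h : ε < ‖f.comp (lpTail X p n)‖) :
    ∃ (m : ℕ) (x : lp X p), ‖x‖ ≤ 1 ∧ (∀ i < n, x i = 0) ∧ (∀ i, m ≤ i → x i = 0) ∧ ε < f x := by
  obtain ⟨x, hx, hfx⟩ := ContinuousLinearMap.exists_lt_apply_of_lt_opNorm _ h
  obtain ⟨y, hy, hfy⟩ : ∃ y : lp X p, ‖y‖ ≤ 1 ∧ ε < f (lpTail X p n y) := by
    rcases lt_abs.1 hfx with h | h
    · exact ⟨x, hx.le, h⟩
    · exact ⟨-x, by simpa using hx.le, by simpa using h⟩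
  set w := lpTail X p n y with hw
  have hlim : Tendsto (fun m => f (∑ i ∈ Finset.range m, lp.single p i (w i))) atTop (𝓝 (f w)) :=
    (f.continuous.tendsto w).comp (lp.hasSum_single hp w).tendsto_sum_nat
  obtain ⟨m, hm⟩ := (hlim.eventually (lt_mem_nhds hfy)).exists
  refine ⟨m, _, (norm_sum_single_le hp m w).trans ((norm_lpTail_apply_le hp n y).trans hy),
    fun i hi => ?_, fun i hi => ?_, hm⟩
  · rw [sum_single_apply, hw, lpTail_apply]
    simp [hi]
  · rw [sum_single_apply, if_neg (by omega)]

/-- Stacks `N` disjointly supported blocks from the unit ball, each with `f`-value above `ε`; the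
`p`-th powers of their norms add. -/
theorem exists_norm_rpow_le_of_lt_norm_comp_lpTail (hp : p ≠ ∞) {f : StrongDual ℝ (lp X p)} {ε : ℝ}
    (h : ∀ n, ε < ‖f.comp (lpTail X p n)‖) (N n : ℕ) :
    ∃ y : lp X p, (∀ i < n, y i = 0) ∧ ‖y‖ ^ p.toReal ≤ N ∧ N * ε ≤ f y := by
  have h0 := toReal_pos_of_one_le p hp
  induction N generalizing n with
  | zero => exact ⟨0, fun i _ => rfl, by simp [Real.zero_rpow h0.ne'], by simp⟩
  | succ N ih =>
    obtain ⟨m, x, hx1, hxn, hxm, hfx⟩ := exists_block_of_lt_norm_comp_lpTail hp (h n)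
    obtain ⟨y, hym, hyN, hfy⟩ := ih (max n m)
    refine ⟨x + y, fun i hi => ?_, ?_, ?_⟩
    · rw [lp.coeFn_add, Pi.add_apply, hxn i hi, hym i (lt_max_of_lt_left hi), add_zero]
    · have hs : HasSum (fun i => ‖(x + y) i‖ ^ p.toReal) (‖x‖ ^ p.toReal + ‖y‖ ^ p.toReal) := by
        convert! (lp.hasSum_norm h0 x).add (lp.hasSum_norm h0 y) using 2 with i
        rw [lp.coeFn_add, Pi.add_apply]
        rcases lt_or_ge i m with hi | hi
        · simp [hym i (lt_max_of_lt_right hi), Real.zero_rpow h0.ne']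
        · simp [hxm i hi, Real.zero_rpow h0.ne']
      rw [(lp.hasSum_norm h0 (x + y)).unique hs]
      have := Real.rpow_le_one (norm_nonneg x) hx1 h0.le
      push_cast
      linarith
    · rw [map_add]
      push_cast
      linarith

/-- If the tails of `f` stayed above `ε`, stacked blocks would give `N * ε ≤ ‖f‖ * N ^ (1 / p)` for
all `N ≥ 1`, impossible for `p > 1`. No description of the dual as an `ℓ^q`-sum is needed. -/
theorem tendsto_norm_comp_lpTail (hp1 : 1 < p) (hp : p ≠ ∞) (f : StrongDual ℝ (lp X p)) :
    Tendsto (fun n => ‖f.comp (lpTail X p n)‖) atTop (𝓝 0) := by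
  have hq : 1 < p.toReal := by
    rw [← ENNReal.toReal_one]
    exact (ENNReal.toReal_lt_toReal ENNReal.one_ne_top hp).2 hp1
  have h0 : 0 < p.toReal := zero_lt_one.trans hq
  suffices h : ∀ ε > 0, ∃ n, ‖f.comp (lpTail X p n)‖ ≤ ε by
    rw [Metric.tendsto_atTop]
    intro ε hε
    obtain ⟨n, hn⟩ := h (ε / 2) (half_pos hε)
    refine ⟨n, fun m hm => ?_⟩
    rw [Real.dist_0_eq_abs, abs_of_nonneg (norm_nonneg _)]
    linarith [norm_comp_lpTail_antitone hp f hm]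
  intro ε hε
  by_contra! hcon
  have hexp : 0 < 1 - p.toReal⁻¹ := sub_pos.2 (inv_lt_one_of_one_lt₀ hq)
  have hlim : Tendsto (fun N : ℕ => (N : ℝ) ^ (1 - p.toReal⁻¹)) atTop atTop :=
    (tendsto_rpow_atTop hexp).comp tendsto_natCast_atTop_atTop
  obtain ⟨N, hN, hN1⟩ := ((hlim.eventually_gt_atTop (‖f‖ / ε)).and (eventually_ge_atTop 1)).exists
  obtain ⟨y, -, hyN, hfy⟩ := exists_norm_rpow_le_of_lt_norm_comp_lpTail hp hcon N 0
  have hNpos : (0 : ℝ) < N := by exact_mod_cast hN1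
  have hy : ‖y‖ ≤ (N : ℝ) ^ p.toReal⁻¹ := by
    rwa [Real.le_rpow_inv_iff_of_pos (norm_nonneg _) hNpos.le h0]
  have h1 : N * ε ≤ ‖f‖ * (N : ℝ) ^ p.toReal⁻¹ :=
    calc N * ε ≤ ‖f y‖ := hfy.trans (le_abs_self _)
      _ ≤ ‖f‖ * ‖y‖ := f.le_opNorm y
      _ ≤ _ := by gcongr
  rw [div_lt_iff₀ hε, Real.rpow_sub hNpos, Real.rpow_one, div_mul_eq_mul_div,
    lt_div_iff₀ (by positivity)] at hN
  exact absurd h1 (not_le.2 hN)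

theorem mem_canonicalImage_lp_of_forall_biadjoint (hp1 : 1 < p) (hp : p ≠ ∞)
    {z : WeakDual ℝ (StrongDual ℝ (lp X p))}
    (hz : ∀ i, biadjoint (lp.evalCLM ℝ X p i) z ∈ canonicalImage (X i)) :
    z ∈ canonicalImage (lp X p) := by
  have h0 := toReal_pos_of_one_le p hp
  choose x hx using fun i => mem_canonicalImage_iff.1 (hz i)
  have hsplit := eq_comp_lpTail_add_sum hx
  set C := ‖WeakDual.toStrongDual z‖ with hC
  have hzle : ∀ f, ‖z f‖ ≤ C * ‖f‖ := (WeakDual.toStrongDual z).le_opNorm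
  -- One `C` bounds `z f`, the other bounds `z` on the tail of `f`. A bound uniform in `n` puts the
  -- coordinate sequence in `ℓ^p`.
  have hbound : ∀ n, ‖(∑ i ∈ Finset.range n, lp.single p i (x i) : lp X p)‖ ≤ 2 * C := by
    intro n
    refine NormedSpace.norm_le_dual_bound ℝ _ (by positivity) fun f => ?_
    have h1 : ‖f.comp (lpTail X p n)‖ ≤ ‖f‖ := by
      refine ContinuousLinearMap.opNorm_le_bound _ (norm_nonneg _) fun y => ?_
      exact (f.le_opNorm _).trans (by gcongr; exact norm_lpTail_apply_le hp n y)
    calc ‖f (∑ i ∈ Finset.range n, lp.single p i (x i))‖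
        = ‖z f - z (f.comp (lpTail X p n))‖ := by rw [hsplit n f]; congr 1; ring
      _ ≤ C * ‖f‖ + C * ‖f.comp (lpTail X p n)‖ :=
          (norm_sub_le _ _).trans (add_le_add (hzle _) (hzle _))
      _ ≤ C * ‖f‖ + C * ‖f‖ := by gcongr
      _ = 2 * C * ‖f‖ := by ring
  have hmem : Memℓp x p := by
    refine memℓp_gen' (C := (2 * C) ^ p.toReal) fun s => ?_
    obtain ⟨n, hn⟩ := s.exists_nat_subset_range
    calc ∑ i ∈ s, ‖x i‖ ^ p.toReal ≤ ∑ i ∈ Finset.range n, ‖x i‖ ^ p.toReal :=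
          Finset.sum_le_sum_of_subset_of_nonneg hn fun i _ _ => by positivity
      _ = ‖(∑ i ∈ Finset.range n, lp.single p i (x i) : lp X p)‖ ^ p.toReal :=
          (lp.norm_sum_single h0 x _).symm
      _ ≤ (2 * C) ^ p.toReal := Real.rpow_le_rpow (norm_nonneg _) (hbound n) h0.le
  refine mem_canonicalImage_iff.2 ⟨⟨x, hmem⟩, fun f => ?_⟩
  have hl1 : Tendsto (fun n => z (f.comp (lpTail X p n))) atTop (𝓝 0) := by
    refine squeeze_zero_norm (fun n => hzle _) ?_
    simpa using (tendsto_norm_comp_lpTail hp1 hp f).const_mul C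
  have hl2 : Tendsto (fun n => f (∑ i ∈ Finset.range n, lp.single p i (x i))) atTop
      (𝓝 (f ⟨x, hmem⟩)) :=
    (f.continuous.tendsto _).comp (lp.hasSum_single hp ⟨x, hmem⟩).tendsto_sum_nat
  have hl := hl1.add hl2
  simp only [← hsplit, zero_add] at hl
  exact tendsto_nhds_unique tendsto_const_nhds hl

end ExponentGreaterOne

/-! ### Describing the canonical image of the sum -/

section LpSum

variable {X : ℕ → Type*} [∀ n, NormedAddCommGroup (X n)] [∀ n, NormedSpace ℝ (X n)]
  {p : ℝ≥0∞} [Fact (1 ≤ p)]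

/-- The elements of the second dual of the sum whose restriction to functionals vanishing on the
first `n` summands has norm at most `1 / (k + 1)`. -/
def bidualSmallTail (X : ℕ → Type*) [∀ n, NormedAddCommGroup (X n)] [∀ n, NormedSpace ℝ (X n)]
    (p : ℝ≥0∞) [Fact (1 ≤ p)] (k n : ℕ) : Set (WeakDual ℝ (StrongDual ℝ (lp X p))) :=
  {z | ∀ f : StrongDual ℝ (lp X p), |z (f.comp (lpTail X p n))| ≤ 1 / (k + 1) * ‖f‖}

theorem isClosed_bidualSmallTail (k n : ℕ) : IsClosed (bidualSmallTail X p k n) := by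
  simp only [bidualSmallTail, ofPred_forall]
  exact isClosed_iInter fun f => isClosed_le (WeakDual.eval_continuous _).abs continuous_const

theorem mem_bidualSmallTail_of_norm_lpTail_le {z : WeakDual ℝ (StrongDual ℝ (lp X p))} {x : lp X p}
    (hx : ∀ f : StrongDual ℝ (lp X p), z f = f x) {k n : ℕ}
    (h : ‖lpTail X p n x‖ ≤ 1 / ((k : ℝ) + 1)) : z ∈ bidualSmallTail X p k n := fun f => by
  rw [hx, mul_comm]
  exact (f.le_opNorm _).trans (mul_le_mul_of_nonneg_left h (norm_nonneg f))

theorem canonicalImage_lp_eq [∀ n, CompleteSpace (X n)] (hp : p ≠ ∞) :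
    canonicalImage (lp X p) =
      (⋂ i, biadjoint (lp.evalCLM ℝ X p i) ⁻¹' canonicalImage (X i)) ∩
        ⋂ k, ⋃ n, bidualSmallTail X p k n := by
  refine Subset.antisymm (fun z hz => ⟨mem_iInter.2 fun i => biadjoint_evalCLM_mem hz i,
    mem_iInter.2 fun k => mem_iUnion.2 ?_⟩) ?_
  · obtain ⟨x, hx⟩ := mem_canonicalImage_iff.1 hz
    have := (tendsto_lpTail hp x).norm
    rw [norm_zero] at this
    obtain ⟨n, hn⟩ := (this.eventually
      (gt_mem_nhds (Nat.one_div_pos_of_nat (α := ℝ) (n := k)))).exists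
    exact ⟨n, mem_bidualSmallTail_of_norm_lpTail_le hx hn.le⟩
  · rintro z ⟨hz1, hz2⟩
    choose x hx using fun i => mem_canonicalImage_iff.1 (mem_iInter.1 hz1 i)
    refine mem_canonicalImage_of_forall_exists_abs_sub_le fun ε hε => ?_
    obtain ⟨k, hk⟩ := exists_nat_one_div_lt hε
    obtain ⟨n, hn⟩ := mem_iUnion.1 (mem_iInter.1 hz2 k)
    -- The small tail puts `z` within `1 / (k + 1)` of this truncation in norm, and the canonical
    -- image is norm closed by completeness.
    refine ⟨∑ i ∈ Finset.range n, lp.single p i (x i), fun f => ?_⟩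
    rw [sub_eq_of_eq_add (eq_comp_lpTail_add_sum hx n f)]
    exact (hn f).trans (mul_le_mul_of_nonneg_right hk.le (norm_nonneg f))

theorem isKSigmaDeltaIf_canonicalImage_lp [∀ n, CompleteSpace (X n)] (hp : p ≠ ∞) {s : Prop}
    (h : ∀ n, IsKSigmaDeltaIf s (canonicalImage (X n))) :
    IsKSigmaDeltaIf s (canonicalImage (lp X p)) := by
  have key := fun D => IsKSigmaDeltaIf.iInter_preimage_inter (D := D)
    (fun r : ℕ => WeakDual.isCompact_closedBall (𝕜 := ℝ) (0 : StrongDual ℝ (StrongDual ℝ (lp X p))) r)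
    (fun L hL => WeakDual.exists_nat_subset_closedBall hL)
    (fun i => continuous_biadjoint (lp.evalCLM ℝ X p i)) h
  rcases eq_or_lt_of_le (Fact.out : 1 ≤ p) with rfl | hp1
  · rw [canonicalImage_lp_eq hp]
    refine key _ isClosed_bidualSmallTail fun _ L hL hLA k => ?_
    rw [← canonicalImage_lp_eq hp] at hLA
    obtain ⟨n, hn⟩ := exists_forall_norm_lpTail_le_of_isCompact hL hLA
      (Nat.one_div_pos_of_nat (α := ℝ) (n := k))
    refine ⟨n, fun z hz => ?_⟩
    obtain ⟨x, rfl⟩ := hLA hz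
    exact mem_bidualSmallTail_of_norm_lpTail_le (fun f => rfl) (hn x hz)
  -- The tail condition is replaced by a trivial one: for `p > 1` it is automatic, and it would not
  -- absorb compact sets, as the unit ball of `ℓ^2` shows.
  · have heq : canonicalImage (lp X p) =
        (⋂ i, biadjoint (lp.evalCLM ℝ X p i) ⁻¹' canonicalImage (X i)) ∩
          ⋂ _ : ℕ, ⋃ _ : ℕ, univ := by
      simp only [iUnion_const, iInter_const, inter_univ]
      exact Subset.antisymm (fun z hz => mem_iInter.2 fun i => biadjoint_evalCLM_mem hz i)
        fun z hz => mem_canonicalImage_lp_of_forall_biadjoint hp1 hp (mem_iInter.1 hz)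
    rw [heq]
    exact key (fun _ _ => univ) (fun _ _ => isClosed_univ) fun _ L _ _ _ => ⟨0, subset_univ L⟩

end LpSum

theorem mainTheorem9 (X : ℕ → Type*) [∀ n, NormedAddCommGroup (X n)] [∀ n, NormedSpace ℝ (X n)]
    [∀ n, CompleteSpace (X n)] (p : ℝ≥0∞) [Fact (1 ≤ p)] (hp : p ≠ ∞) :
    ((∀ n, IsKSigmaDeltaBanach (X n)) → IsKSigmaDeltaBanach (lp X p)) ∧
      ((∀ n, IsStronglyKSigmaDeltaBanach (X n)) → IsStronglyKSigmaDeltaBanach (lp X p)) :=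
  ⟨fun h => isKSigmaDeltaIf_false.1
      (isKSigmaDeltaIf_canonicalImage_lp hp fun n => isKSigmaDeltaIf_false.2 (h n)),
    fun h => isKSigmaDeltaIf_true.1
      (isKSigmaDeltaIf_canonicalImage_lp hp fun n => isKSigmaDeltaIf_true.2 (h n))⟩
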